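/- Let $d$ be a positive integer and let $\mathbb N_d$ be the set of positive integers coprime to $d$. Let $\Phi_s(t)$ denote the $s$-th cyclotomic polynomial, and let $$\Gamma_d=\mathbb Z[1/d][t^{\pm1}]\Bigl[\tfrac1{\Phi_s(t)}\ :\ s\ge 1,\ s\notin\mathbb N_d\Bigr]\subset\mathbb Q(t).$$ For a set $S\subset\mathbb N_d$ let $\Phi_S^*$ be the multiplicative set (containing $1$) generated by the polynomials $\Phi_r(t)$, $r\in S$, directed by divisibility, and let $$\Gamma_d^S=\varprojlim_{f\in\Phi_S^*}\Gamma_d/(f).$$ For $S'\subset S$ let $\rho_{S,S'}:\Gamma_d^S\to\Gamma_d^{S'}$ be the natural ring homomorphism, which restricts compatible families to the indices $f\in\Phi_{S'}^*\subset\Phi_S^*$. Two positive integers $n,n'$ are called adjacent if $n/n'=p^e$ for some prime $p$ and some integer $e$. For $S'\subset S\subset\mathbb N_d$ write $S'\prec S$ if for every $n\in S$ there are $k\ge1$, $n_1,\dots,n_k\in S$ and $n_{k+1}\in S'$ with $n_1=n$ and with $n_i$ and $n_{i+1}$ adjacent for $1\le i\le k$. **Theorem.** If $S_0\prec S\subset\mathbb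 N_d$, then $\rho_{S,S_0}:\Gamma_d^S\to\Gamma_d^{S_0}$ is injective. -/

import Mathlib

namespace CycComp

open Polynomial

/-- `ℕ_d`: the set of positive integers coprime with `d`. -/
def Nd (d : ℕ) : Set ℕ := {n | 0 < n ∧ Nat.Coprime n d}

/-- `A_d = ℤ[1/d][t^{±1}]`, as a subring of `ℚ(t)`. -/
noncomputable def A (d : ℕ) : Subring (RatFunc ℚ) :=
  Subring.closure {(d : RatFunc ℚ)⁻¹, RatFunc.X, (RatFunc.X)⁻¹}

/-- `Γ_d = A_d[1/Φ_s(t) : s a positive integer, s ∉ ℕ_d]`, as a subring of `ℚ(t)`. -/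
noncomputable def Gam (d : ℕ) : Subring (RatFunc ℚ) :=
  Subring.closure ((A d : Set (RatFunc ℚ)) ∪
    {z | ∃ s : ℕ, 0 < s ∧ s ∉ Nd d ∧ z = (aeval (RatFunc.X : RatFunc ℚ) (cyclotomic s ℤ))⁻¹})

theorem X_mem_Gam (d : ℕ) : (RatFunc.X : RatFunc ℚ) ∈ Gam d :=
  Subring.subset_closure (Or.inl (Subring.subset_closure (by simp)))

/-- The variable `t` as an element of `Γ_d`. -/
noncomputable def tGam (d : ℕ) : Gam d := ⟨RatFunc.X, X_mem_Gam d⟩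

/-- `Φ_S^*`: the multiplicative set generated by the cyclotomic polynomials `Φ_r`, `r ∈ S`.
Its elements have integer coefficients and are monic, so divisibility among them is the same
in `ℤ[t]` and in `ℤ[1/d][t]`. -/
noncomputable def phiStar (S : Set ℕ) : Submonoid ℤ[X] :=
  Submonoid.closure ((fun r : ℕ => cyclotomic r ℤ) '' S)

theorem phiStar_mono {S' S : Set ℕ} (h : S' ⊆ S) : phiStar S' ≤ phiStar S :=
  Submonoid.closure_mono (Set.image_mono h)

variable {R : Type*} [CommRing R]

/-- The principal ideal `(f(t))` of `R`. -/
def idl (t : R) (f : ℤ[X]) : Ideal R := Ideal.span {aeval t f}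

theorem idl_le (t : R) {f g : ℤ[X]} (h : f ∣ g) : idl t g ≤ idl t f :=
  Ideal.span_singleton_le_span_singleton.2 (map_dvd (aeval t) h)

/-- The completion `R^S = lim R/(f(t))`, the inverse limit over `f ∈ Φ_S^*` directed by
divisibility: the ring of compatible families in `∏ R/(f(t))`. -/
def completion (t : R) (S : Set ℕ) : Subring (∀ f : phiStar S, R ⧸ idl t (f : ℤ[X])) where
  carrier := {x | ∀ (f g : phiStar S) (h : (f : ℤ[X]) ∣ (g : ℤ[X])),
    Ideal.Quotient.factor (idl_le t h) (x g) = x f}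
  mul_mem' := by
    intro a b ha hb f g h
    simp only [Pi.mul_apply, map_mul, ha f g h, hb f g h]
  one_mem' := by
    intro f g h
    simp only [Pi.one_apply, map_one]
  add_mem' := by
    intro a b ha hb f g h
    simp only [Pi.add_apply, map_add, ha f g h, hb f g h]
  zero_mem' := by
    intro f g h
    simp only [Pi.zero_apply, map_zero]
  neg_mem' := by
    intro a ha f g h
    simp only [Pi.neg_apply, map_neg, ha f g h]

/-- The natural map `ρ_{S,S'} : R^S → R^{S'}` for `S' ⊆ S`, restricting a compatible family to
the indices in `Φ_{S'}^* ⊆ Φ_S^*`. -/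
def rho (t : R) {S S' : Set ℕ} (h : S' ⊆ S) : completion t S →+* completion t S' where
  toFun x := ⟨fun f => x.1 ⟨f.1, phiStar_mono h f.2⟩, fun f g hfg =>
    x.2 ⟨f.1, phiStar_mono h f.2⟩ ⟨g.1, phiStar_mono h g.2⟩ hfg⟩
  map_one' := rfl
  map_mul' _ _ := rfl
  map_zero' := rfl
  map_add' _ _ := rfl

/-- `n` and `n'` are adjacent: `n / n' = p ^ e` for a prime `p` and an integer `e`. -/
def Adjacent (n n' : ℕ) : Prop :=
  ∃ (p : ℕ) (e : ℤ), p.Prime ∧ (n : ℚ) / (n' : ℚ) = (p : ℚ) ^ e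

/-- `S' ≺ S`: `S' ⊆ S`, and every `n ∈ S` has a chain `n = n_1, …, n_k ∈ S`, `n_{k+1} ∈ S'` with
consecutive terms adjacent. -/
structure Prec (S' S : Set ℕ) : Prop where
  subset : S' ⊆ S
  chain : ∀ n ∈ S, ∃ (k : ℕ) (a : ℕ → ℕ), 1 ≤ k ∧ a 1 = n ∧
    (∀ i, 1 ≤ i → i ≤ k → a i ∈ S ∧ Adjacent (a i) (a (i + 1))) ∧ a (k + 1) ∈ S'

end CycComp

/-! An element of the kernel vanishes at every power of `Φ_m` with `m ∈ S₀`; this vanishing is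
carried along chains to all of `S`. Let `n`, `m` be adjacent, and suppose `x` vanishes at all powers
of `Φ_m`. The component of `x` at `Φ_n^k Φ_m^j` shows that a lift of its `Φ_n^k`-component lies in
`(Φ_n^k) + (Φ_m^j)` for every `j`. Since `Γ_d` is a Noetherian domain, `Φ_n` is prime in it and
`(Φ_n, Φ_m)` is proper, Krull's theorem makes this component zero (`completion_apply_pow_eq_zero`).
An arbitrary index is a product of powers of primes `Φ_r`, none dividing another, so all components
vanish.

Properness is the arithmetic input (`span_sup_span_ne_top`): for distinct adjacent indices `p^a c`
and `p^b c`, the two polynomials have a common root in characteristic `p`, at which no denominator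
of `Γ_d` vanishes. -/

namespace CycComp

open Polynomial

/-! ### Injectivity over a Noetherian domain, by Krull's theorem -/

section Completion

variable {R : Type*} [CommRing R]

/-- Krull's intersection theorem in `R / (f ^ i)`, for a prime element `f` such that `f` and `g`
generate a proper ideal. -/
theorem pow_dvd_of_forall_mem_sup [IsDomain R] [IsNoetherianRing R] {f g : R} (hf : Prime f)
    (hfg : Ideal.span {f} ⊔ Ideal.span {g} ≠ ⊤) (i : ℕ) {x : R}
    (hx : ∀ j, x ∈ Ideal.span {f ^ i} ⊔ Ideal.span {g ^ j}) : f ^ i ∣ x := by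
  have hmem : Ideal.Quotient.mk (Ideal.span {f ^ i}) x ∈
      (⨅ j : ℕ, Ideal.span {g} ^ j • ⊤ : Submodule R (R ⧸ Ideal.span {f ^ i})) := by
    rw [Submodule.mem_iInf]
    intro j
    obtain ⟨a, ha, b, hb, hab⟩ := Submodule.mem_sup.1 (hx j)
    rw [← hab, map_add, Ideal.Quotient.eq_zero_iff_mem.2 ha, zero_add,
      show Ideal.Quotient.mk (Ideal.span {f ^ i}) b
        = b • (1 : R ⧸ Ideal.span {f ^ i}) by rw [Algebra.smul_def, mul_one]; rfl,
      Ideal.span_singleton_pow]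
    exact Submodule.smul_mem_smul hb trivial
  -- Krull: some `r ∈ (g)` fixes the class of `x`. If `f` divided `1 - r`, then `1 = (1 - r) + r`
  -- would lie in `(f) + (g)`.
  obtain ⟨⟨r, hr⟩, hrx⟩ := (Ideal.mem_iInf_smul_pow_eq_bot_iff _ _).1 hmem
  have hz : f ^ i ∣ (1 - r) * x := by
    rw [← Ideal.mem_span_singleton, ← Ideal.Quotient.eq_zero_iff_mem, sub_mul, one_mul, map_sub,
      sub_eq_zero]
    exact hrx.symm
  refine hf.pow_dvd_of_dvd_mul_left i (fun h1 => hfg ?_) hz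
  rw [Ideal.eq_top_iff_one, ← sub_add_cancel 1 r]
  exact Ideal.add_mem _ (Ideal.mem_sup_left (Ideal.mem_span_singleton.2 h1))
    (Ideal.mem_sup_right hr)

/-- An element divisible by all the prime powers `Φ_r ^ k` that divide `g ∈ Φ_S^*` is divisible
by `g`. -/
theorem aeval_dvd_of_forall_pow_dvd [IsDomain R] {t : R} {S : Set ℕ}
    (hprime : ∀ n ∈ S, Prime (aeval t (cyclotomic n ℤ)))
    (hnd : ∀ n ∈ S, ∀ m ∈ S, n ≠ m → ¬ aeval t (cyclotomic n ℤ) ∣ aeval t (cyclotomic m ℤ))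
    {g : ℤ[X]} (hg : g ∈ phiStar S) (y : R)
    (hy : ∀ r ∈ S, ∀ k : ℕ, cyclotomic r ℤ ^ k ∣ g → aeval t (cyclotomic r ℤ) ^ k ∣ y) :
    aeval t g ∣ y := by
  induction hg using Submonoid.closure_induction_left generalizing y with
  | one => simp
  | mul_left a ha g' hg' ih =>
    obtain ⟨r, hr, rfl⟩ := ha
    dsimp only at hy ⊢
    obtain ⟨y', rfl⟩ : aeval t (cyclotomic r ℤ) ∣ y := by
      simpa using hy r hr 1 (by simp)
    rw [map_mul]
    refine mul_dvd_mul_left _ (ih y' fun s hs k hk => ?_)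
    -- For `s = r` the exponent is raised by one and the extra factor cancelled; otherwise the prime
    -- `Φ_s` does not divide `Φ_r`.
    by_cases hsr : s = r
    · subst hsr
      have h := hy s hs (k + 1) (by rw [pow_succ']; exact mul_dvd_mul_left _ hk)
      rw [pow_succ'] at h
      exact (mul_dvd_mul_iff_left (hprime s hs).ne_zero).1 h
    · exact (hprime s hs).pow_dvd_of_dvd_mul_left k (hnd s hs r hr hsr)
        (hy s hs k (hk.mul_left _))

theorem pow_cyclotomic_mem_phiStar {S : Set ℕ} {n : ℕ} (hn : n ∈ S) (k : ℕ) :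
    cyclotomic n ℤ ^ k ∈ phiStar S :=
  pow_mem (Submonoid.subset_closure (Set.mem_image_of_mem _ hn)) k

/-- If `y` lifts the `g`-component of `x`, then the `f`-component of `x` vanishes iff
`f` divides `y`, for every `f` dividing `g`. -/
theorem completion_apply_eq_zero_iff {t : R} {S : Set ℕ} (x : completion t S)
    {f g : phiStar S} (hfg : (f : ℤ[X]) ∣ (g : ℤ[X])) {y : R}
    (hy : Ideal.Quotient.mk (idl t (g : ℤ[X])) y = x.1 g) :
    x.1 f = 0 ↔ aeval t (f : ℤ[X]) ∣ y := by
  rw [← x.2 f g hfg, ← hy, Ideal.Quotient.factor_mk, Ideal.Quotient.eq_zero_iff_mem, idl,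
    Ideal.mem_span_singleton]

/-- Vanishing at all powers of `Φ_m` propagates to all powers of `Φ_n`. -/
theorem completion_apply_pow_eq_zero [IsDomain R] [IsNoetherianRing R] {t : R} {S : Set ℕ} {n m : ℕ}
    (hn : n ∈ S) (hm : m ∈ S) (hprime : Prime (aeval t (cyclotomic n ℤ)))
    (hnm : Ideal.span {aeval t (cyclotomic n ℤ)} ⊔ Ideal.span {aeval t (cyclotomic m ℤ)} ≠ ⊤)
    (x : completion t S)
    (hx : ∀ k, x.1 ⟨cyclotomic m ℤ ^ k, pow_cyclotomic_mem_phiStar hm k⟩ = 0) (k : ℕ) :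
    x.1 ⟨cyclotomic n ℤ ^ k, pow_cyclotomic_mem_phiStar hn k⟩ = 0 := by
  obtain ⟨y, hy⟩ := Ideal.Quotient.mk_surjective
    (x.1 ⟨cyclotomic n ℤ ^ k, pow_cyclotomic_mem_phiStar hn k⟩)
  rw [completion_apply_eq_zero_iff x dvd_rfl hy]
  simp only [map_pow]
  refine pow_dvd_of_forall_mem_sup hprime hnm k fun j => ?_
  -- A lift `z` of the component at this index is divisible by `Φ_m^j` and congruent to `y` modulo
  -- `Φ_n^k`.
  let g : phiStar S := ⟨cyclotomic n ℤ ^ k * cyclotomic m ℤ ^ j,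
    mul_mem (pow_cyclotomic_mem_phiStar hn k) (pow_cyclotomic_mem_phiStar hm j)⟩
  obtain ⟨z, hz⟩ := Ideal.Quotient.mk_surjective (x.1 g)
  have hzm := (completion_apply_eq_zero_iff x (f := ⟨_, pow_cyclotomic_mem_phiStar hm j⟩)
    (Dvd.intro_left _ rfl) hz).1 (hx j)
  have hzn := x.2 ⟨_, pow_cyclotomic_mem_phiStar hn k⟩ g (Dvd.intro _ rfl)
  rw [← hz, Ideal.Quotient.factor_mk, ← hy, eq_comm, Ideal.Quotient.mk_eq_mk_iff_sub_mem] at hzn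
  rw [← sub_add_cancel y z]
  refine Ideal.add_mem _ (Ideal.mem_sup_left ?_)
    (Ideal.mem_sup_right (Ideal.mem_span_singleton.2 ?_))
  · simpa [idl] using hzn
  · simpa using hzm

theorem rho_injective_of_sup_ne_top [IsDomain R] [IsNoetherianRing R] {t : R} {S S₀ : Set ℕ}
    (hprime : ∀ n ∈ S, Prime (aeval t (cyclotomic n ℤ)))
    (hnd : ∀ n ∈ S, ∀ m ∈ S, n ≠ m → ¬ aeval t (cyclotomic n ℤ) ∣ aeval t (cyclotomic m ℤ))
    (hadj : ∀ n ∈ S, ∀ m ∈ S, Adjacent n m →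
      Ideal.span {aeval t (cyclotomic n ℤ)} ⊔ Ideal.span {aeval t (cyclotomic m ℤ)} ≠ ⊤)
    (h : Prec S₀ S) : Function.Injective (rho t h.subset) := by
  rw [injective_iff_map_eq_zero]
  intro x hx
  have hS₀ (f : phiStar S₀) : x.1 ⟨f.1, phiStar_mono h.subset f.2⟩ = 0 :=
    congrFun (congrArg Subtype.val hx) f
  have hpow (n : ℕ) (hn : n ∈ S) (k : ℕ) :
      x.1 ⟨cyclotomic n ℤ ^ k, pow_cyclotomic_mem_phiStar hn k⟩ = 0 := by
    obtain ⟨l, a, hl, rfl, hchain, hend⟩ := h.chain n hn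
    have hmem (i : ℕ) (hi : 1 ≤ i) (hil : i ≤ l + 1) : a i ∈ S := by
      rcases hil.eq_or_lt with rfl | hlt
      · exact h.subset hend
      · exact (hchain i hi (by omega)).1
    -- Induction backwards along the chain, from its end in `S₀`.
    have hdesc (i : ℕ) (hi : i ≤ l) : ∃ hs : a (l + 1 - i) ∈ S, ∀ k,
        x.1 ⟨cyclotomic (a (l + 1 - i)) ℤ ^ k, pow_cyclotomic_mem_phiStar hs k⟩ = 0 := by
      induction i with
      | zero =>
        exact ⟨h.subset hend, fun k => hS₀ ⟨_, pow_cyclotomic_mem_phiStar hend k⟩⟩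
      | succ i ih =>
        obtain ⟨hs, hz⟩ := ih (by omega)
        have hs' : a (l + 1 - (i + 1)) ∈ S := hmem _ (by omega) (by omega)
        have hA := (hchain (l + 1 - (i + 1)) (by omega) (by omega)).2
        rw [show l + 1 - (i + 1) + 1 = l + 1 - i by omega] at hA
        exact ⟨hs', completion_apply_pow_eq_zero hs' hs (hprime _ hs') (hadj _ hs' _ hs hA) x hz⟩
    have hfirst := hdesc l le_rfl
    rw [Nat.add_sub_cancel_left] at hfirst
    exact hfirst.2 k
  refine Subtype.ext (funext fun g => ?_)
  obtain ⟨y, hy⟩ := Ideal.Quotient.mk_surjective (x.1 g)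
  refine (completion_apply_eq_zero_iff x dvd_rfl hy).2
    (aeval_dvd_of_forall_pow_dvd hprime hnd g.2 y fun r hr k hk => ?_)
  rw [← map_pow]
  exact (completion_apply_eq_zero_iff x (f := ⟨_, pow_cyclotomic_mem_phiStar hr k⟩) hk hy).1
    (hpow r hr k)

end Completion

/-! ### `Γ_d` as a localization of `ℤ[t]` -/

/-- The denominators of `Γ_d`: the multiplicative set generated by `d`, `t` and the cyclotomic
polynomials `Φ_s` with `s ∉ ℕ_d`. -/
noncomputable def denominators (d : ℕ) : Submonoid ℤ[X] :=
  Submonoid.closure ({(d : ℤ[X]), X} ∪ {f | ∃ s : ℕ, 0 < s ∧ s ∉ Nd d ∧ f = cyclotomic s ℤ})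

noncomputable instance algebraGam (d : ℕ) : Algebra ℤ[X] (Gam d) :=
  (aeval (tGam d)).toRingHom.toAlgebra

theorem algebraMap_Gam (d : ℕ) (f : ℤ[X]) : algebraMap ℤ[X] (Gam d) f = aeval (tGam d) f := rfl

theorem coe_aeval_tGam (d : ℕ) (f : ℤ[X]) :
    ((aeval (tGam d) f : Gam d) : RatFunc ℚ) = aeval (RatFunc.X : RatFunc ℚ) f := by
  rw [aeval_def, aeval_def]
  refine (hom_eval₂ f _ (Gam d).subtype (tGam d)).trans ?_
  rw [RingHom.ext_int ((Gam d).subtype.comp (algebraMap ℤ (Gam d))) (algebraMap ℤ (RatFunc ℚ))]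
  rfl

theorem aeval_ratFuncX_injective :
    Function.Injective (aeval (RatFunc.X : RatFunc ℚ) : ℤ[X] → RatFunc ℚ) := by
  intro f g hfg
  have key (f : ℤ[X]) : aeval (RatFunc.X : RatFunc ℚ) f
      = algebraMap ℚ[X] (RatFunc ℚ) (f.map (algebraMap ℤ ℚ)) := by
    rw [← RatFunc.aeval_X_left_eq_algebraMap, aeval_map_algebraMap]
  rw [key, key] at hfg
  exact map_injective _ (algebraMap ℤ ℚ).injective_int (RatFunc.algebraMap_injective ℚ hfg)

theorem algebraMap_Gam_injective (d : ℕ) : Function.Injective (algebraMap ℤ[X] (Gam d)) :=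
  fun f g hfg => aeval_ratFuncX_injective <| by
    rw [← coe_aeval_tGam d, ← coe_aeval_tGam d]; exact congrArg Subtype.val hfg

theorem isUnit_of_inv_mem {d : ℕ} {z : Gam d} (hz : z ≠ 0) (h : (z : RatFunc ℚ)⁻¹ ∈ Gam d) :
    IsUnit z :=
  IsUnit.of_mul_eq_one ⟨_, h⟩ (Subtype.ext (mul_inv_cancel₀ (by simpa using hz)))

theorem isUnit_algebraMap_Gam {d : ℕ} (hd : 0 < d) {f : ℤ[X]} (hf : f ∈ denominators d) :
    IsUnit (algebraMap ℤ[X] (Gam d) f) := by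
  induction hf using Submonoid.closure_induction with
  | one => simp
  | mul f g _ _ hf hg => rw [map_mul]; exact hf.mul hg
  | mem f hf =>
    have hne (g : ℤ[X]) (hg : g ≠ 0) : algebraMap ℤ[X] (Gam d) g ≠ 0 :=
      (map_ne_zero_iff _ (algebraMap_Gam_injective d)).2 hg
    rcases hf with (rfl | rfl) | ⟨s, hs, hsd, rfl⟩
    · refine isUnit_of_inv_mem (hne _ (by exact_mod_cast hd.ne')) ?_
      exact Subring.subset_closure (Or.inl (Subring.subset_closure (by simp)))
    · refine isUnit_of_inv_mem (hne _ X_ne_zero) ?_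
      rw [algebraMap_Gam, coe_aeval_tGam, aeval_X]
      exact Subring.subset_closure (Or.inl (Subring.subset_closure (by simp)))
    · refine isUnit_of_inv_mem (hne _ (cyclotomic_ne_zero s ℤ)) ?_
      rw [algebraMap_Gam, coe_aeval_tGam]
      exact Subring.subset_closure (Or.inr ⟨s, hs, hsd, rfl⟩)

/-- Every element of `Γ_d` is a fraction with denominator in `denominators d`. -/
theorem exists_mul_aeval_eq {d : ℕ} {z : RatFunc ℚ} (hz : z ∈ Gam d) :
    ∃ a : ℤ[X], ∃ b ∈ denominators d,
      z * aeval (RatFunc.X : RatFunc ℚ) b = aeval (RatFunc.X : RatFunc ℚ) a := by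
  have hinv (b : ℤ[X]) (hb : b ∈ denominators d) : ∃ a : ℤ[X], ∃ b' ∈ denominators d,
      (aeval (RatFunc.X : RatFunc ℚ) b)⁻¹ * aeval (RatFunc.X : RatFunc ℚ) b'
        = aeval (RatFunc.X : RatFunc ℚ) a := by
    by_cases h0 : aeval (RatFunc.X : RatFunc ℚ) b = 0
    · exact ⟨0, 1, one_mem _, by simp [h0]⟩
    · exact ⟨1, b, hb, by rw [map_one, inv_mul_cancel₀ h0]⟩
  have hmul {x y : RatFunc ℚ} (hx : ∃ a : ℤ[X], ∃ b ∈ denominators d,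
        x * aeval (RatFunc.X : RatFunc ℚ) b = aeval (RatFunc.X : RatFunc ℚ) a)
      (hy : ∃ a : ℤ[X], ∃ b ∈ denominators d,
        y * aeval (RatFunc.X : RatFunc ℚ) b = aeval (RatFunc.X : RatFunc ℚ) a) :
      ∃ a : ℤ[X], ∃ b ∈ denominators d,
        x * y * aeval (RatFunc.X : RatFunc ℚ) b = aeval (RatFunc.X : RatFunc ℚ) a := by
    obtain ⟨a, b, hb, h⟩ := hx
    obtain ⟨a', b', hb', h'⟩ := hy
    exact ⟨a * a', b * b', mul_mem hb hb', by rw [map_mul, map_mul, ← h, ← h']; ring⟩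
  have hadd {x y : RatFunc ℚ} (hx : ∃ a : ℤ[X], ∃ b ∈ denominators d,
        x * aeval (RatFunc.X : RatFunc ℚ) b = aeval (RatFunc.X : RatFunc ℚ) a)
      (hy : ∃ a : ℤ[X], ∃ b ∈ denominators d,
        y * aeval (RatFunc.X : RatFunc ℚ) b = aeval (RatFunc.X : RatFunc ℚ) a) :
      ∃ a : ℤ[X], ∃ b ∈ denominators d,
        (x + y) * aeval (RatFunc.X : RatFunc ℚ) b = aeval (RatFunc.X : RatFunc ℚ) a := by
    obtain ⟨a, b, hb, h⟩ := hx
    obtain ⟨a', b', hb', h'⟩ := hy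
    refine ⟨a * b' + a' * b, b * b', mul_mem hb hb', ?_⟩
    rw [map_add, map_mul, map_mul, map_mul, ← h, ← h']
    ring
  have hneg {x : RatFunc ℚ} (hx : ∃ a : ℤ[X], ∃ b ∈ denominators d,
        x * aeval (RatFunc.X : RatFunc ℚ) b = aeval (RatFunc.X : RatFunc ℚ) a) :
      ∃ a : ℤ[X], ∃ b ∈ denominators d,
        -x * aeval (RatFunc.X : RatFunc ℚ) b = aeval (RatFunc.X : RatFunc ℚ) a := by
    obtain ⟨a, b, hb, h⟩ := hx
    exact ⟨-a, b, hb, by rw [map_neg, ← h, neg_mul]⟩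
  let P : Subring (RatFunc ℚ) :=
    { carrier := {z | ∃ a : ℤ[X], ∃ b ∈ denominators d,
        z * aeval (RatFunc.X : RatFunc ℚ) b = aeval (RatFunc.X : RatFunc ℚ) a}
      mul_mem' := hmul
      one_mem' := ⟨1, 1, one_mem _, by simp⟩
      add_mem' := hadd
      zero_mem' := ⟨0, 1, one_mem _, by simp⟩
      neg_mem' := hneg }
  suffices hP : Gam d ≤ P from hP hz
  refine Subring.closure_le.2 (Set.union_subset (Subring.closure_le.2 ?_) ?_)
  · rintro _ (rfl | rfl | rfl)
    · change ∃ a : ℤ[X], ∃ b ∈ denominators d, _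
      simpa using hinv d (Submonoid.subset_closure (Or.inl (Or.inl rfl)))
    · exact ⟨X, 1, one_mem _, by simp⟩
    · change ∃ a : ℤ[X], ∃ b ∈ denominators d, _
      simpa using hinv X (Submonoid.subset_closure (Or.inl (Or.inr rfl)))
  · rintro _ ⟨s, hs, hsd, rfl⟩
    exact hinv _ (Submonoid.subset_closure (Or.inr ⟨s, hs, hsd, rfl⟩))

/-- This yields Noetherianity, the primality of the `Φ_n`, and the evaluation maps out of `Γ_d`. -/
theorem isLocalization_Gam {d : ℕ} (hd : 0 < d) : IsLocalization (denominators d) (Gam d) := by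
  rw [isLocalization_iff]
  refine ⟨fun y => isUnit_algebraMap_Gam hd y.2, fun z => ?_, fun h =>
    ⟨1, by rw [algebraMap_Gam_injective d h]⟩⟩
  obtain ⟨a, b, hb, h⟩ := exists_mul_aeval_eq z.2
  refine ⟨(a, ⟨b, hb⟩), Subtype.ext ?_⟩
  rw [Subring.coe_mul, algebraMap_Gam, algebraMap_Gam, coe_aeval_tGam, coe_aeval_tGam]
  exact h

/-! ### Evaluation at roots of unity -/

section Evaluation

variable {K : Type*} [Field K] {d : ℕ} {ζ : K}

theorem aeval_ne_zero_of_mem_denominators (hdK : (d : K) ≠ 0) (hζ : ζ ≠ 0)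
    (hcyc : ∀ s : ℕ, 0 < s → s ∉ Nd d → aeval ζ (cyclotomic s ℤ) ≠ 0)
    {f : ℤ[X]} (hf : f ∈ denominators d) : aeval ζ f ≠ 0 := by
  induction hf using Submonoid.closure_induction with
  | one => simp
  | mul f g _ _ hf hg => rw [map_mul]; exact mul_ne_zero hf hg
  | mem f hf =>
    rcases hf with (rfl | rfl) | ⟨s, hs, hsd, rfl⟩
    · simpa using hdK
    · simpa using hζ
    · exact hcyc s hs hsd

/-- Evaluation at `ζ` extends to `Γ_d` when no denominator vanishes at `ζ`. -/
theorem exists_ringHom_Gam (hd : 0 < d) (hden : ∀ f ∈ denominators d, aeval ζ f ≠ 0) :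
    ∃ φ : Gam d →+* K, ∀ f : ℤ[X], φ (aeval (tGam d) f) = aeval ζ f := by
  have := isLocalization_Gam hd
  have hu (f : denominators d) : IsUnit ((aeval ζ : ℤ[X] →ₐ[ℤ] K).toRingHom f) :=
    (hden f f.2).isUnit
  exact ⟨IsLocalization.lift hu, fun f => IsLocalization.lift_eq hu f⟩

theorem aeval_cyclotomic_eq_zero_iff_isRoot (ζ : K) (n : ℕ) :
    aeval ζ (cyclotomic n ℤ) = 0 ↔ (cyclotomic n K).IsRoot ζ := by
  rw [IsRoot.def, ← map_cyclotomic_int n K, eval_map, aeval_def, algebraMap_int_eq]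

theorem aeval_cyclotomic_eq_zero_iff [CharZero K] {n : ℕ} (hn : 0 < n) :
    aeval ζ (cyclotomic n ℤ) = 0 ↔ IsPrimitiveRoot ζ n := by
  have : NeZero (n : K) := ⟨by exact_mod_cast hn.ne'⟩
  rw [aeval_cyclotomic_eq_zero_iff_isRoot, isRoot_cyclotomic_iff]

/-- In characteristic `p`, `Φ_{p^k m}` is a power of `Φ_m` when `p ∤ m`. -/
theorem aeval_cyclotomic_prime_pow_mul_eq_zero_iff {p : ℕ} [Fact p.Prime] [CharP K p] {m : ℕ}
    (hm : ¬ p ∣ m) (k : ℕ) :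
    aeval ζ (cyclotomic (p ^ k * m) ℤ) = 0 ↔ IsPrimitiveRoot ζ m := by
  have : NeZero (m : K) := ⟨by rwa [Ne, CharP.cast_eq_zero_iff K p]⟩
  rw [aeval_cyclotomic_eq_zero_iff_isRoot, isRoot_cyclotomic_prime_pow_mul_iff_of_charP]

end Evaluation

/-! ### Cyclotomic polynomials in `Γ_d` -/

theorem aeval_primitiveRoot_ne_zero_of_mem_denominators {d n : ℕ} (hd : 0 < d) (hn : n ∈ Nd d) {ζ : ℂ}
    (hζ : IsPrimitiveRoot ζ n) {f : ℤ[X]} (hf : f ∈ denominators d) : aeval ζ f ≠ 0 := by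
  refine aeval_ne_zero_of_mem_denominators (by exact_mod_cast hd.ne') (hζ.ne_zero hn.1.ne')
    (fun s hs hsd h0 => hsd ?_) hf
  rwa [((aeval_cyclotomic_eq_zero_iff hs).1 h0).unique hζ]

/-- A prime ideal of `ℤ[t]` disjoint from the denominators stays prime in the localization;
evaluation at a complex primitive `n`-th root of unity gives disjointness. -/
theorem prime_aeval_cyclotomic {d n : ℕ} (hd : 0 < d) (hn : n ∈ Nd d) :
    Prime (aeval (tGam d) (cyclotomic n ℤ)) := by
  have := isLocalization_Gam hd
  have hne : aeval (tGam d) (cyclotomic n ℤ) ≠ 0 := by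
    rw [← algebraMap_Gam, map_ne_zero_iff _ (algebraMap_Gam_injective d)]
    exact cyclotomic_ne_zero n ℤ
  have hp := (cyclotomic.irreducible hn.1).prime
  rw [← Ideal.span_singleton_prime hne]
  have h := IsLocalization.isPrime_of_isPrime_disjoint (denominators d) (Gam d)
    (Ideal.span {cyclotomic n ℤ}) ((Ideal.span_singleton_prime hp.ne_zero).2 hp) ?_
  · rwa [Ideal.map_span, Set.image_singleton] at h
  · refine Set.disjoint_left.2 fun f hf hfn => ?_
    have hζ := Complex.isPrimitiveRoot_exp n hn.1.ne'
    refine aeval_primitiveRoot_ne_zero_of_mem_denominators hd hn hζ hf ?_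
    obtain ⟨g, rfl⟩ := Ideal.mem_span_singleton.1 hfn
    rw [map_mul, (aeval_cyclotomic_eq_zero_iff hn.1).2 hζ, zero_mul]

theorem not_aeval_cyclotomic_dvd {d n m : ℕ} (hd : 0 < d) (hn : n ∈ Nd d) (hm : m ∈ Nd d)
    (hnm : n ≠ m) :
    ¬ aeval (tGam d) (cyclotomic n ℤ) ∣ aeval (tGam d) (cyclotomic m ℤ) := by
  intro h
  have hζ := Complex.isPrimitiveRoot_exp n hn.1.ne'
  obtain ⟨φ, hφ⟩ := exists_ringHom_Gam hd
    fun f hf => aeval_primitiveRoot_ne_zero_of_mem_denominators hd hn hζ hf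
  have h' := map_dvd φ h
  rw [hφ, hφ, (aeval_cyclotomic_eq_zero_iff hn.1).2 hζ, zero_dvd_iff,
    aeval_cyclotomic_eq_zero_iff hm.1] at h'
  exact hnm (hζ.unique h')

/-- Adjacent positive integers have the same prime-to-`p` part for some prime `p`. -/
theorem Adjacent.exists_eq_pow_mul {n m : ℕ} (h : Adjacent n m) (hn : 0 < n) (hm : 0 < m) :
    ∃ p a b c : ℕ, p.Prime ∧ ¬ p ∣ c ∧ n = p ^ a * c ∧ m = p ^ b * c := by
  obtain ⟨p, e, hp, h⟩ := h
  have hmQ : (m : ℚ) ≠ 0 := by exact_mod_cast hm.ne'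
  have hpQ : (p : ℚ) ≠ 0 := by exact_mod_cast hp.ne_zero
  rw [div_eq_iff hmQ] at h
  obtain ⟨u, rfl | rfl⟩ := e.eq_nat_or_neg
  · obtain ⟨b, c, hc, rfl⟩ := Nat.exists_eq_pow_mul_and_not_dvd hm.ne' p hp.ne_one
    refine ⟨p, u + b, b, c, hp, hc, ?_, rfl⟩
    rw [zpow_natCast] at h
    rw [pow_add, mul_assoc]
    exact_mod_cast h
  · obtain ⟨a, c, hc, rfl⟩ := Nat.exists_eq_pow_mul_and_not_dvd hn.ne' p hp.ne_one
    refine ⟨p, a, u + a, c, hp, hc, rfl, ?_⟩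
    rw [zpow_neg, zpow_natCast, eq_inv_mul_iff_mul_eq₀ (pow_ne_zero _ hpQ)] at h
    rw [pow_add, mul_assoc]
    exact_mod_cast h.symm

/-- Both generators lie in the kernel of evaluation at a primitive `c`-th root of unity over `𝔽_p`,
where `c` is the common prime-to-`p` part. -/
theorem span_sup_span_ne_top {d n m : ℕ} (hd : 0 < d) (hn : n ∈ Nd d) (hm : m ∈ Nd d)
    (h : Adjacent n m) :
    Ideal.span {aeval (tGam d) (cyclotomic n ℤ)} ⊔
      Ideal.span {aeval (tGam d) (cyclotomic m ℤ)} ≠ ⊤ := by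
  -- Equal indices give no control on `p`, which might divide `d`.
  by_cases hnm : n = m
  · subst hnm
    rw [sup_idem, Ne, Ideal.span_singleton_eq_top]
    exact (prime_aeval_cyclotomic hd hn).not_isUnit
  obtain ⟨p, a, b, c, hp, hc, rfl, rfl⟩ := h.exists_eq_pow_mul hn.1 hm.1
  have hpd : p.Coprime d := by
    rcases Nat.eq_zero_or_pos a with rfl | ha
    · rcases Nat.eq_zero_or_pos b with rfl | hb
      · exact absurd rfl hnm
      · exact hm.2.coprime_dvd_left ((dvd_pow_self p hb.ne').mul_right c)
    · exact hn.2.coprime_dvd_left ((dvd_pow_self p ha.ne').mul_right c)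
  have hcd : c.Coprime d := hn.2.coprime_dvd_left (Dvd.intro_left _ rfl)
  have : Fact p.Prime := ⟨hp⟩
  let K := AlgebraicClosure (ZMod p)
  have : CharP K p := AlgebraicClosure.instCharP (ZMod p)
  have : NeZero (c : K) := ⟨by rwa [Ne, CharP.cast_eq_zero_iff K p]⟩
  obtain ⟨ζ, hζ⟩ := HasEnoughRootsOfUnity.exists_primitiveRoot K c
  have hc0 : c ≠ 0 := fun h0 => hc (h0 ▸ dvd_zero p)
  have hden (f : ℤ[X]) (hf : f ∈ denominators d) : aeval ζ f ≠ 0 := by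
    refine aeval_ne_zero_of_mem_denominators ?_ (hζ.ne_zero hc0) (fun s hs hsd h0 => hsd ?_) hf
    · rwa [Ne, CharP.cast_eq_zero_iff K p, ← hp.coprime_iff_not_dvd]
    -- If `Φ_s` vanished at `ζ`, then `s' = c`, so `s = p^k c` would be coprime to `d`.
    · obtain ⟨k, s', hs', rfl⟩ := Nat.exists_eq_pow_mul_and_not_dvd hs.ne' p hp.ne_one
      rw [aeval_cyclotomic_prime_pow_mul_eq_zero_iff hs'] at h0
      rw [h0.unique hζ] at hs ⊢
      exact ⟨hs, (hpd.pow_left k).mul_left hcd⟩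
  obtain ⟨φ, hφ⟩ := exists_ringHom_Gam hd hden
  refine ne_top_of_le_ne_top (RingHom.ker_ne_top φ) (sup_le ?_ ?_) <;>
  · rw [Ideal.span_singleton_le_iff_mem, RingHom.mem_ker, hφ,
      aeval_cyclotomic_prime_pow_mul_eq_zero_iff hc]
    exact hζ

theorem isNoetherianRing_Gam {d : ℕ} (hd : 0 < d) : IsNoetherianRing (Gam d) :=
  have := isLocalization_Gam hd
  IsLocalization.isNoetherianRing (denominators d) (Gam d) inferInstance

end CycComp

theorem mainTheorem9 (d : ℕ) (hd : 0 < d) (S S₀ : Set ℕ) (hS : S ⊆ CycComp.Nd d)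
    (h : CycComp.Prec S₀ S) :
    Function.Injective (CycComp.rho (CycComp.tGam d) h.subset) :=
  have := CycComp.isNoetherianRing_Gam hd
  CycComp.rho_injective_of_sup_ne_top
    (fun _ hn => CycComp.prime_aeval_cyclotomic hd (hS hn))
    (fun _ hn _ hm => CycComp.not_aeval_cyclotomic_dvd hd (hS hn) (hS hm))
    (fun _ hn _ hm => CycComp.span_sup_span_ne_top hd (hS hn) (hS hm)) h
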